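/- Let $n\ge 2$. For a word $u$ of distinct positive integers, let $\mathrm{red}(u)$ be the word obtained by replacing the $i$-th smallest letter of $u$ by $i$; two words $u,v$ are order-isomorphic if $\mathrm{red}(u)=\mathrm{red}(v)$. For a positive integer $b$ put $c_b(x)=x$ if $x<b$ and $c_b(x)=x+1$ if $x\ge b$. For a word $v=v_1\cdots v_m$ of distinct letters and $1\le i\le m+1$, the $i$-th extension of $v$ is $c_b(v_1)\cdots c_b(v_m)\,b$, where $b$ is the $i$-th smallest letter of $v$ if $i\le m$, and $b=\max_j v_j+1$ if $i=m+1$. The greedy algorithm starts with the word $12\cdots(n-1)$. Given the current word $w=w_1\cdots w_l$, let $i\in\{1,\dots,n\}$ be minimal such that the $i$-th extension of the last $n-1$ letters of $w$ is not order-isomorphic to any factor (block of consecutive letters) of $w$ of length $n$, let $b$ be the last letter of this extension, and replace $w$ by $c_b(w_1)\cdots c_b(w_l)\,b$. If there is no such $i$, the algorithm stops and outputs $w$. Then the algorithm stops, and its (unique) output $\Pi'_n=a_1a_2\cdots$ has length $n!+n-1$. For $1\le k\le n!$ let $\sigma_k=\mathrm{red}(a_ka_{k+1}\cdots a_{k+n-1})$.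 Then $$a_{n!/2+1}=1,\qquad \sigma_{n!/2}=n12\cdots(n-1),\qquad \sigma_{n!/2+1}=134\cdots n2,$$ and, if $n\ge 3$, $\sigma_{n!/2+2}=23\cdots(n-1)1n$. Moreover, $\{\sigma_k: 1\le k\le n!/2\}$ is exactly the set of permutations of $\{1,\dots,n\}$ (in one-line notation) in which $n$ stands before $1$, and $\{\sigma_k: n!/2<k\le n!\}$ is exactly the set of those in which $1$ stands before $n$. -/

import Mathlib

namespace GreedyPerm

/-- The reduced form of a word: every letter is replaced by its rank among the letters of the word
(the `i`-th smallest letter becomes `i`). -/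
def red (u : List ℕ) : List ℕ :=
  u.map fun x => (u.toFinset.filter (· ≤ x)).card

/-- The shift `c_b`: `x` if `x < b`, and `x + 1` if `x ≥ b`. -/
def shift (b x : ℕ) : ℕ := if x < b then x else x + 1

/-- The word `c_b(w₁) c_b(w₂) ⋯ c_b(w_l) b`. -/
def append (w : List ℕ) (b : ℕ) : List ℕ := w.map (shift b) ++ [b]

/-- The last letter `b` of the `i`-th extension (`1 ≤ i ≤ m + 1`) of a word `v` of `m` distinct
letters: the `i`-th smallest letter of `v` if `i ≤ m`, and one more than the largest letter of `v`
if `i = m + 1`. -/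
def extLetter (v : List ℕ) (i : ℕ) : ℕ :=
  if i ≤ v.length then (v.insertionSort (· ≤ ·)).getD (i - 1) 0 else v.foldr max 0 + 1

/-- The `i`-th extension of `v` to the right, `1 ≤ i ≤ v.length + 1`. For `i = v.length + 1` all
letters of `v` are smaller than the new letter `b`, so this is `v` followed by `b`. -/
def extension (v : List ℕ) (i : ℕ) : List ℕ := append v (extLetter v i)

/-- Some factor of length `n` of `w` is order-isomorphic to `p`. -/
def Covers (n : ℕ) (w p : List ℕ) : Prop :=
  ∃ u, u <:+: w ∧ u.length = n ∧ red u = red p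

/-- One step of the greedy algorithm: `i` is minimal such that the `i`-th extension of the last
`n - 1` letters of `w` is order-isomorphic to no factor of `w` of length `n`, and the last letter of
this extension is appended to `w`. -/
def Step (n : ℕ) (w w' : List ℕ) : Prop :=
  ∃ i, IsLeast {i | 1 ≤ i ∧ i ≤ n ∧ ¬ Covers n w (extension (w.rtake (n - 1)) i)} i ∧
    w' = append w (extLetter (w.rtake (n - 1)) i)

/-- `w` is the output of the greedy algorithm: it is reached from `12⋯(n-1)` by greedy steps, and no
further step is possible. -/
def IsOutput (n : ℕ) (w : List ℕ) : Prop :=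
  Relation.ReflTransGen (Step n) (List.range' 1 (n - 1)) w ∧ ¬ ∃ w', Step n w w'

/-- The `k`-th letter of `w`, counted from `1`. -/
def letter (w : List ℕ) (k : ℕ) : Option ℕ := w[k - 1]?

/-- `σ_k`, the reduced form of the factor `a_k a_{k+1} ⋯ a_{k+n-1}` of `w = a_1 a_2 ⋯`. -/
def sigma (n : ℕ) (w : List ℕ) (k : ℕ) : List ℕ := red ((w.drop (k - 1)).take n)

/-- The `n`-permutations, in one-line notation, in which the letter `a` stands before `b`. -/
def permsBefore (n a b : ℕ) : Set (List ℕ) :=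
  {p | p.Perm (List.range' 1 n) ∧ p.idxOf a < p.idxOf b}

end GreedyPerm

namespace GreedyPerm

/-! Put m = n - 1 and consider the digraph whose nodes are the permutations of 1, …, m and whose
edges are the permutations of 1, …, n. An edge p goes from the pattern of its first m letters
(`src`) to the pattern of its last m letters (`tgt`) and is labelled by its last letter. The shifts
preserve all earlier patterns, so appending a letter to a word adds one edge to a walk. The i-th
extension is the edge with label i, so the algorithm walks from 12⋯m, always along the unused
outgoing edge of smallest label (`IsGreedy`).

Such a walk is governed by `greedy_walk_covers`. If no node has more incoming than outgoing edges, a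
stuck walk has returned to its start, and all edges leaving the start are used. If all edges leaving
a node are used, then by counting so are all edges entering it. If one of these has maximal label at
its source, greediness forces every edge leaving that source to be used as well. Hence everything is
used once edges of maximal label lead from every node to the start (`leads_perms`). This yields all
n! patterns.

The same principle applies to the subgraph `half` of edges in which n stands before 1. At every node
the labels of its edges form an initial segment (`mem_half_iff`), so the walk leaves `half` only
when the current node has no unused edge of `half`: up to then it is a stuck greedy walk in `half`.
Balance is `half_balanced`, the paths of maximal labels are `leads_half`, and reversal of words
shows that `half` has n!/2 elements. So the first n!/2 patterns are exactly those of `half`, and the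
walk is then back at 12⋯m. The explicit letters and patterns at the midpoint follow from this
return. -/

/-! ### Patterns, ranks and shifts -/

/-- The rank of `x` among the letters of `u`. -/
def rank (u : List ℕ) (x : ℕ) : ℕ := (u.toFinset.filter (· ≤ x)).card

theorem red_eq_map (u : List ℕ) : red u = u.map (rank u) := rfl

@[simp] theorem length_red (u : List ℕ) : (red u).length = u.length := by simp [red]

theorem rank_lt_rank {u : List ℕ} {x y : ℕ} (hy : y ∈ u) (h : x < y) : rank u x < rank u y := by
  refine Finset.card_lt_card ⟨fun z hz => ?_, fun hs => ?_⟩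
  · simp only [Finset.mem_filter] at hz ⊢
    exact ⟨hz.1, hz.2.trans h.le⟩
  · have := @hs y (by simp [hy])
    simp only [Finset.mem_filter] at this
    omega

theorem strictMonoOn_rank (u : List ℕ) : StrictMonoOn (rank u) {x | x ∈ u} :=
  fun _ _ _ hy h => rank_lt_rank hy h

theorem rank_map {u : List ℕ} {f : ℕ → ℕ} (hf : StrictMonoOn f {x | x ∈ u}) {x : ℕ} (hx : x ∈ u) :
    rank (u.map f) (f x) = rank u x := by
  have h : (u.map f).toFinset.filter (· ≤ f x) = (u.toFinset.filter (· ≤ x)).image f := by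
    ext z
    simp only [Finset.mem_filter, List.mem_toFinset, List.mem_map, Finset.mem_image]
    constructor
    · rintro ⟨⟨y, hy, rfl⟩, hle⟩
      exact ⟨y, ⟨hy, (hf.le_iff_le hy hx).1 hle⟩, rfl⟩
    · rintro ⟨y, ⟨hy, hle⟩, rfl⟩
      exact ⟨⟨y, hy, rfl⟩, (hf.le_iff_le hy hx).2 hle⟩
  rw [rank, h, Finset.card_image_of_injOn, rank]
  intro a ha b hb hab
  simp only [Finset.coe_filter, List.mem_toFinset, Set.mem_ofPred_eq] at ha hb
  exact hf.injOn ha.1 hb.1 hab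

theorem red_map {u : List ℕ} {f : ℕ → ℕ} (hf : StrictMonoOn f {x | x ∈ u}) :
    red (u.map f) = red u := by
  rw [red_eq_map, red_eq_map, List.map_map]
  exact List.map_congr_left fun x hx => rank_map hf hx

theorem red_map_rank {u s : List ℕ} (h : s ⊆ u) : red (s.map (rank u)) = red s :=
  red_map ((strictMonoOn_rank u).mono fun _ hx => h hx)

theorem nodup_red {u : List ℕ} (h : u.Nodup) : (red u).Nodup :=
  h.map_on fun _ hx _ hy hxy => (strictMonoOn_rank u).injOn hx hy hxy

theorem one_le_rank {u : List ℕ} {x : ℕ} (hx : x ∈ u) : 1 ≤ rank u x :=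
  Finset.card_pos.2 ⟨x, by simp [hx]⟩

theorem rank_le_length (u : List ℕ) (x : ℕ) : rank u x ≤ u.length :=
  (Finset.card_filter_le _ _).trans u.toFinset_card_le

theorem perm_range'_of_nodup {l : List ℕ} {n : ℕ} (h : l.Nodup) (hn : l.length = n)
    (hl : ∀ x ∈ l, 1 ≤ x ∧ x ≤ n) : l.Perm (List.range' 1 n) := by
  refine (List.subperm_of_subset h fun x hx => ?_).perm_of_length_le (by simp [hn])
  have := hl x hx
  rw [List.mem_range'_1]; omega

theorem red_perm {u : List ℕ} (h : u.Nodup) : (red u).Perm (List.range' 1 u.length) := by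
  refine perm_range'_of_nodup (nodup_red h) (length_red u) fun x hx => ?_
  rw [red_eq_map, List.mem_map] at hx
  obtain ⟨y, hy, rfl⟩ := hx
  exact ⟨one_le_rank hy, rank_le_length u y⟩

theorem mem_of_perm {p : List ℕ} {n : ℕ} (hp : p.Perm (List.range' 1 n)) {x : ℕ} :
    x ∈ p ↔ 1 ≤ x ∧ x ≤ n := by
  rw [hp.mem_iff, List.mem_range'_1]; omega

theorem nodup_of_perm {p : List ℕ} {n : ℕ} (hp : p.Perm (List.range' 1 n)) : p.Nodup :=
  hp.nodup_iff.2 List.nodup_range'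

theorem length_of_perm {p : List ℕ} {n : ℕ} (hp : p.Perm (List.range' 1 n)) : p.length = n := by
  simpa using hp.length_eq

theorem red_eq_self {p : List ℕ} {n : ℕ} (hp : p.Perm (List.range' 1 n)) : red p = p := by
  conv_rhs => rw [← List.map_id p]
  refine List.map_congr_left fun x hx => ?_
  have hx' := (mem_of_perm hp).1 hx
  have : p.toFinset.filter (· ≤ x) = Finset.Icc 1 x := by
    ext y
    simp only [Finset.mem_filter, List.mem_toFinset, mem_of_perm hp, Finset.mem_Icc]
    omega
  rw [this]; simp

theorem shift_strictMono (b : ℕ) : StrictMono (shift b) := by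
  intro x y h
  unfold shift
  split_ifs <;> omega

theorem shift_ne (b x : ℕ) : shift b x ≠ b := by
  unfold shift
  split_ifs <;> omega

theorem red_map_shift (u : List ℕ) (b : ℕ) : red (u.map (shift b)) = red u :=
  red_map ((shift_strictMono b).strictMonoOn _)

@[simp] theorem length_append' (w : List ℕ) (b : ℕ) : (append w b).length = w.length + 1 := by
  simp [append]

theorem nodup_append {w : List ℕ} (h : w.Nodup) (b : ℕ) : (append w b).Nodup := by
  rw [append, List.nodup_append]
  refine ⟨h.map (shift_strictMono b).injective, by simp, ?_⟩
  rintro a ha c hc rfl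
  obtain ⟨x, -, hx⟩ := List.mem_map.1 ha
  exact shift_ne b x (hx.trans (by simpa using hc))

theorem append_perm {v : List ℕ} {m i : ℕ} (hv : v.Perm (List.range' 1 m)) (h1 : 1 ≤ i)
    (h2 : i ≤ m + 1) : (append v i).Perm (List.range' 1 (m + 1)) := by
  refine perm_range'_of_nodup (nodup_append (nodup_of_perm hv) i)
    (by simp [length_of_perm hv]) fun x hx => ?_
  rw [append, List.mem_append, List.mem_map, List.mem_singleton] at hx
  obtain ⟨y, hy, rfl⟩ | rfl := hx
  · have := (mem_of_perm hv).1 hy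
    unfold shift
    split_ifs <;> omega
  · omega

/-- Removing one letter from a permutation and reducing is undone by the shift. -/
theorem eq_map_shift_red {l : List ℕ} {i n : ℕ} (h : (i :: l).Perm (List.range' 1 n)) :
    l = (red l).map (shift i) := by
  have hi : 1 ≤ i ∧ i ≤ n := (mem_of_perm h).1 (by simp)
  have hnd := nodup_of_perm h
  have hlen := length_of_perm h
  rw [List.nodup_cons] at hnd
  have hl : ∀ x ∈ l, 1 ≤ x ∧ x ≤ n ∧ x ≠ i := fun x hx => by
    have := (mem_of_perm h).1 (List.mem_cons_of_mem i hx)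
    exact ⟨this.1, this.2, fun e => hnd.1 (e ▸ hx)⟩
  -- Left inverse of `shift i` away from `i`: it closes the gap left by the removed letter.
  let g : ℕ → ℕ := fun x => if x < i then x else x - 1
  have hg : StrictMonoOn g {x | x ∈ l} := by
    intro x hx y hy hxy
    have h1 := hl x hx
    have h2 := hl y hy
    simp only [g]
    split_ifs <;> omega
  have hq : (l.map g).Perm (List.range' 1 (n - 1)) := by
    refine perm_range'_of_nodup (hnd.2.map_on fun x hx y hy e => hg.injOn hx hy e)
      (by simp at hlen ⊢; omega) fun x hx => ?_
    obtain ⟨y, hy, rfl⟩ := List.mem_map.1 hx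
    have h1 := hl y hy
    simp only [g]
    split_ifs <;> omega
  rw [← red_map hg, red_eq_self hq, List.map_map]
  conv_lhs => rw [← List.map_id l]
  refine List.map_congr_left fun x hx => ?_
  have h1 := hl x hx
  simp only [g, shift, Function.comp, id]
  split_ifs <;> omega

theorem concat_eq_append {x n : ℕ} {l : List ℕ} (h : (l ++ [x]).Perm (List.range' 1 n)) :
    l ++ [x] = append (red l) x := by
  rw [append, ← eq_map_shift_red (i := x) (n := n)]
  exact (List.perm_append_singleton x l).symm.trans h

theorem red_concat {v : List ℕ} {y : ℕ} (h : (v ++ [y]).Nodup) :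
    red (v ++ [y]) = append (red v) (rank (v ++ [y]) y) := by
  have h1 := red_perm h
  rw [red_eq_map, List.map_append, List.map_singleton] at h1 ⊢
  rw [concat_eq_append h1, red_map_rank (by simp)]

/-- The tail of a reduced word, reduced again. -/
theorem red_tail_red (u : List ℕ) : red (red u).tail = red u.tail := by
  rw [red_eq_map u, ← List.map_tail, red_map_rank (List.tail_subset u)]

theorem red_dropLast_red (u : List ℕ) : red (red u).dropLast = red u.dropLast := by
  rw [red_eq_map u, ← List.map_dropLast, red_map_rank (List.dropLast_subset u)]

/-- Just i - 1 letters of `v` lie below the new letter, and `shift` fixes these and pushes all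
others above it. This ties the index of an extension to the label of an edge. -/
theorem extLetter_eq {v : List ℕ} (hv : v.Nodup) {i : ℕ} (h1 : 1 ≤ i) (h2 : i ≤ v.length + 1) :
    rank (append v (extLetter v i)) (extLetter v i) = i := by
  set b := extLetter v i with hb
  have hS : (append v b).toFinset.filter (· ≤ b) = insert b (v.toFinset.filter (· < b)) := by
    ext z
    simp only [append, Finset.mem_filter, List.mem_toFinset, List.mem_append, List.mem_map,
      List.mem_singleton, Finset.mem_insert]
    constructor
    · rintro ⟨⟨y, hy, rfl⟩ | h, hz⟩
      · right
        unfold shift at hz ⊢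
        split_ifs at hz ⊢ <;> first | exact ⟨hy, by omega⟩ | omega
      · exact Or.inl h
    · rintro (rfl | ⟨hz, hlt⟩)
      · exact ⟨Or.inr rfl, le_rfl⟩
      · exact ⟨Or.inl ⟨z, hz, by simp [shift, hlt]⟩, hlt.le⟩
  rw [rank, hS, Finset.card_insert_of_notMem (by simp)]
  by_cases hi : i ≤ v.length
  · set t := v.insertionSort (· ≤ ·) with ht
    have htp : t.Perm v := List.perm_insertionSort _ v
    have hti : i - 1 < t.length := by rw [htp.length_eq]; omega
    have hbt : b = t[i - 1] := by
      rw [hb, extLetter, if_pos hi, ← ht, List.getD_eq_getElem _ _ hti]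
    have hnd : t.Nodup := htp.nodup_iff.2 hv
    have hs : t.Pairwise (· ≤ ·) := List.pairwise_insertionSort _ v
    have hmono : ∀ a c (ha : a < t.length) (hc : c < t.length), a < c → t[a] < t[c] := by
      intro a c ha hc hac
      refine lt_of_le_of_ne (List.pairwise_iff_getElem.1 hs a c ha hc hac) fun e => ?_
      have := (hnd.getElem_inj_iff).1 e
      omega
    have hF : v.toFinset.filter (· < b) = (t.take (i - 1)).toFinset := by
      ext z
      simp only [Finset.mem_filter, List.mem_toFinset, List.mem_take_iff_getElem, ← htp.mem_iff]
      constructor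
      · rintro ⟨hz, hlt⟩
        obtain ⟨a, ha, rfl⟩ := List.mem_iff_getElem.1 hz
        refine ⟨a, ?_, rfl⟩
        by_contra hcon
        rcases (show i - 1 ≤ a by omega).eq_or_lt with e | e
        · subst e; omega
        · have := hmono _ _ hti ha e
          omega
      · rintro ⟨a, ha, rfl⟩
        exact ⟨List.getElem_mem _, hbt ▸ hmono _ _ _ _ (by omega)⟩
    rw [hF, List.toFinset_card_of_nodup (hnd.sublist (List.take_sublist _ _)), List.length_take]
    omega
  · have hbt : b = v.foldr max 0 + 1 := by rw [hb, extLetter, if_neg hi]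
    have hF : v.toFinset.filter (· < b) = v.toFinset := by
      refine Finset.filter_true_of_mem fun x hx => ?_
      have : ∀ l : List ℕ, ∀ x ∈ l, x ≤ l.foldr max 0 := by
        intro l
        induction l with
        | nil => simp
        | cons a l ih =>
          intro x hx
          rcases List.mem_cons.1 hx with rfl | hx
          · simp
          · have := ih x hx
            simp only [List.foldr_cons]
            omega
      have := this v x (by simpa using hx)
      omega
    rw [hF, List.toFinset_card_of_nodup hv]
    omega

theorem red_extension {v : List ℕ} (hv : v.Nodup) {i : ℕ} (h1 : 1 ≤ i) (h2 : i ≤ v.length + 1) :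
    red (extension v i) = append (red v) i := by
  have h := nodup_append hv (extLetter v i)
  have h3 := extLetter_eq hv h1 h2
  rw [extension]
  rw [append] at h h3 ⊢
  rw [red_concat h, red_map_shift, h3]

/-! ### Greedy walks in a labelled digraph -/

/-- The node `v` leads to `r` along edges of maximal label. -/
inductive Leads {α β : Type*} (P : Finset α) (src tgt : α → β) (lab : α → ℕ) (r : β) : β → Prop
  | base : Leads P src tgt lab r r
  | step (q : α) : q ∈ P → (∀ p ∈ P, src p = src q → lab p ≤ lab q) →
      Leads P src tgt lab r (tgt q) → Leads P src tgt lab r (src q)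

theorem sum_ite_shift {β : Type*} [DecidableEq β] (ν : ℕ → β) (u : β) (K : ℕ) :
    ((Finset.range K).filter fun k => ν (k + 1) = u).card + (if ν 0 = u then 1 else 0) =
      ((Finset.range K).filter fun k => ν k = u).card + (if ν K = u then 1 else 0) := by
  simp only [Finset.card_filter]
  rw [← Finset.sum_range_succ fun k => if ν k = u then 1 else 0, ← Finset.sum_range_succ' fun k => if ν k = u then 1 else 0]

/-- A greedy walk in a digraph in which no node has more incoming than outgoing edges, stopped when
no edge is left, is closed and uses all edges if edges of maximal label lead from every node to the
starting node. -/
theorem greedy_walk_covers {α β : Type*} [DecidableEq α] [DecidableEq β] (P : Finset α)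
    (src tgt : α → β) (lab : α → ℕ)
    (bal : ∀ u, (P.filter fun p => tgt p = u).card ≤ (P.filter fun p => src p = u).card)
    (K : ℕ) (s : ℕ → α) (ν : ℕ → β) (hmem : ∀ k < K, s k ∈ P)
    (inj : ∀ k < K, ∀ j < k, s j ≠ s k)
    (hsrc : ∀ k < K, src (s k) = ν k) (htgt : ∀ k < K, tgt (s k) = ν (k + 1))
    (stuck : ∀ p ∈ P, src p = ν K → ∃ k < K, s k = p)
    (greedy : ∀ k < K, ∀ q ∈ P, src q = src (s k) → lab q < lab (s k) → ∃ j < k, s j = q)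
    (hlab : ∀ p ∈ P, ∀ q ∈ P, src p = src q → lab p = lab q → p = q)
    (leads : ∀ p ∈ P, Leads P src tgt lab (ν 0) (src p)) :
    ν K = ν 0 ∧ ∀ p ∈ P, ∃ k < K, s k = p := by
  set U := (Finset.range K).image s with hU
  have hUP : U ⊆ P := by
    intro p hp
    obtain ⟨k, hk, rfl⟩ := Finset.mem_image.1 hp
    exact hmem k (Finset.mem_range.1 hk)
  have hinj : Set.InjOn s (Finset.range K : Set ℕ) := by
    intro a ha b hb hab
    simp only [Finset.coe_range, Set.mem_Iio] at ha hb
    rcases lt_trichotomy a b with h | h | h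
    · exact absurd hab (inj b hb a h)
    · exact h
    · exact absurd hab.symm (inj a ha b h)
  have count : ∀ (f : α → β) (u : β), (U.filter fun p => f p = u).card =
      ((Finset.range K).filter fun k => f (s k) = u).card := by
    intro f u
    rw [hU, Finset.filter_image, Finset.card_image_of_injOn]
    exact hinj.mono (Finset.coe_subset.2 (Finset.filter_subset _ _))
  -- At each node the walk enters as often as it leaves, up to its start and its end.
  have flow : ∀ u, (U.filter fun p => tgt p = u).card + (if ν 0 = u then 1 else 0) =
      (U.filter fun p => src p = u).card + (if ν K = u then 1 else 0) := by
    intro u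
    rw [count, count, Finset.filter_congr (q := fun k => ν (k + 1) = u) fun k hk => by
        rw [htgt k (Finset.mem_range.1 hk)], sum_ite_shift ν u K,
      Finset.filter_congr (p := fun k => src (s k) = u) (q := fun k => ν k = u) fun k hk => by
        rw [hsrc k (Finset.mem_range.1 hk)]]
  have mono : ∀ (f : α → β) (u : β),
      (U.filter fun p => f p = u).card ≤ (P.filter fun p => f p = u).card := fun f u =>
    Finset.card_le_card (Finset.filter_subset_filter _ hUP)
  have full : ∀ u, (∀ p ∈ P, src p = u → p ∈ U) →
      (U.filter fun p => src p = u) = P.filter fun p => src p = u := by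
    intro u h
    refine Finset.Subset.antisymm (Finset.filter_subset_filter _ hUP) fun p hp => ?_
    rw [Finset.mem_filter] at hp ⊢
    exact ⟨h p hp.1 hp.2, hp.2⟩
  have memU : ∀ p, p ∈ U ↔ ∃ k < K, s k = p := by simp [hU]
  -- At an end different from the start, the used incoming edges would outnumber the used outgoing
  -- ones, which are all the outgoing ones; this contradicts `bal`.
  have hend : ν K = ν 0 := by
    by_contra hne
    have h1 := flow (ν K)
    rw [if_neg (Ne.symm hne), if_pos rfl, full _ fun p hp h => (memU p).2 (stuck p hp h)] at h1
    have h2 := mono tgt (ν K)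
    have h3 := bal (ν K)
    omega
  have key : ∀ v, Leads P src tgt lab (ν 0) v → ∀ p ∈ P, src p = v → p ∈ U := by
    intro v hv
    induction hv with
    | base => exact fun p hp h => (memU p).2 (stuck p hp (h.trans hend.symm))
    | step q hq hmax _ ih =>
      -- All edges leaving `tgt q` are used, so flow and balance force all edges entering it, among
      -- them `q`, to be used.
      have h1 := flow (tgt q)
      rw [hend, full _ ih] at h1
      have h2 : (U.filter fun p => tgt p = tgt q) = P.filter fun p => tgt p = tgt q :=
        Finset.eq_of_subset_of_card_le (Finset.filter_subset_filter _ hUP)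
          (by have := bal (tgt q); omega)
      have hqU : q ∈ U := by
        have : q ∈ U.filter fun p => tgt p = tgt q := by rw [h2]; simp [hq]
        exact (Finset.mem_filter.1 this).1
      intro p hp hpq
      rcases (hmax p hp hpq).eq_or_lt with h | h
      · rwa [hlab p hp q hq hpq h]
      · obtain ⟨k, hk, rfl⟩ := (memU q).1 hqU
        obtain ⟨j, hj, rfl⟩ := greedy k hk p hp hpq h
        exact (memU _).2 ⟨j, hj.trans hk, rfl⟩
  exact ⟨hend, fun p hp => (memU p).1 (key _ (leads p hp) p hp rfl)⟩

/-! ### The digraph of permutations and its half -/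

/-- The permutations of `1, …, n` in one-line notation. -/
def perms (n : ℕ) : Finset (List ℕ) := (List.range' 1 n).permutations.toFinset

/-- The permutations of `1, …, n` in which `n` stands before `1`. -/
def half (n : ℕ) : Finset (List ℕ) := (perms n).filter fun p => p.idxOf n < p.idxOf 1

/-- The pattern of all letters but the last one. -/
def src (p : List ℕ) : List ℕ := red p.dropLast

/-- The pattern of all letters but the first one. -/
def tgt (p : List ℕ) : List ℕ := red p.tail

/-- The last letter. -/
def lab (p : List ℕ) : ℕ := p.getLastD 0

theorem mem_perms {n : ℕ} {p : List ℕ} : p ∈ perms n ↔ p.Perm (List.range' 1 n) := by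
  simp [perms]

theorem mem_half {n : ℕ} {p : List ℕ} :
    p ∈ half n ↔ p.Perm (List.range' 1 n) ∧ p.idxOf n < p.idxOf 1 := by
  simp [half, mem_perms]

theorem half_subset (n : ℕ) : half n ⊆ perms n := Finset.filter_subset _ _

theorem card_perms (n : ℕ) : (perms n).card = n.factorial := by
  rw [perms, List.toFinset_card_of_nodup (List.nodup_permutations _ List.nodup_range'),
    List.length_permutations, List.length_range']

theorem src_append {v : List ℕ} {m : ℕ} (hv : v.Perm (List.range' 1 m)) (i : ℕ) :
    src (append v i) = v := by
  rw [src, append, List.dropLast_concat, red_map_shift, red_eq_self hv]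

theorem lab_append (v : List ℕ) (i : ℕ) : lab (append v i) = i := by
  rw [lab, append, List.getLastD_concat]

theorem exists_eq_append {m : ℕ} {p : List ℕ} (hp : p ∈ perms (m + 1)) :
    (src p).Perm (List.range' 1 m) ∧ 1 ≤ lab p ∧ lab p ≤ m + 1 ∧ p = append (src p) (lab p) := by
  rw [mem_perms] at hp
  rcases p.eq_nil_or_concat' with rfl | ⟨l, x, rfl⟩
  · simpa using length_of_perm hp
  · have hlen := length_of_perm hp
    have hx := (mem_of_perm hp).1 (show x ∈ l ++ [x] by simp)
    have hl : l.Nodup := (nodup_of_perm hp).sublist (List.sublist_append_left _ _)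
    have e : lab (l ++ [x]) = x := List.getLastD_concat
    have e' : src (l ++ [x]) = red l := by rw [src, List.dropLast_concat]
    rw [e, e']
    refine ⟨?_, hx.1, hx.2, concat_eq_append hp⟩
    have := red_perm hl
    rwa [show l.length = m by simpa using hlen] at this

theorem eq_of_src_lab {m : ℕ} {p q : List ℕ} (hp : p ∈ perms (m + 1)) (hq : q ∈ perms (m + 1))
    (h : src p = src q) (h' : lab p = lab q) : p = q := by
  rw [(exists_eq_append hp).2.2.2, (exists_eq_append hq).2.2.2, h, h']

theorem idxOf_map_of_injOn {l : List ℕ} {f : ℕ → ℕ} (hf : Set.InjOn f {x | x ∈ l}) {x : ℕ}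
    (hx : x ∈ l) : (l.map f).idxOf (f x) = l.idxOf x := by
  induction l with
  | nil => simp at hx
  | cons a l ih =>
    by_cases h : a = x
    · subst h; simp
    · have h' : f a ≠ f x := fun e => h (hf (by simp) hx e)
      have hx' : x ∈ l := by
        rcases List.mem_cons.1 hx with e | e
        · exact absurd e.symm h
        · exact e
      rw [List.map_cons, List.idxOf_cons_ne _ h', List.idxOf_cons_ne _ h,
        ih (hf.mono fun y hy => List.mem_cons_of_mem a hy) hx']

/-- The new letter is last. For `i = 1` it is the minimum, for `i = m + 1` the maximum; otherwise
the old extremes become the new ones and keep their positions. -/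
theorem append_before_iff {v : List ℕ} {m i : ℕ} (hm : 1 ≤ m) (hv : v.Perm (List.range' 1 m))
    (h1 : 1 ≤ i) (h2 : i ≤ m + 1) :
    (append v i).idxOf (m + 1) < (append v i).idxOf 1 ↔
      i = 1 ∨ (i ≤ m ∧ v.idxOf m < v.idxOf 1) := by
  have hinj : Set.InjOn (shift i) {x | x ∈ v} := (shift_strictMono i).injective.injOn
  have m1 : 1 ∈ v := (mem_of_perm hv).2 ⟨le_rfl, hm⟩
  have mm : m ∈ v := (mem_of_perm hv).2 ⟨hm, le_rfl⟩
  have hni : i ∉ v.map (shift i) := fun h => by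
    obtain ⟨x, -, hx⟩ := List.mem_map.1 h
    exact shift_ne i x hx
  have hm' : i ≤ m → (append v i).idxOf (m + 1) = v.idxOf m := fun h => by
    have e : shift i m = m + 1 := by unfold shift; split_ifs <;> omega
    rw [append, List.idxOf_append_of_mem (by rw [← e]; exact List.mem_map_of_mem mm), ← e,
      idxOf_map_of_injOn hinj mm]
  have h1' : 1 < i → (append v i).idxOf 1 = v.idxOf 1 := fun h => by
    have e : shift i 1 = 1 := by unfold shift; split_ifs; rfl
    conv_lhs => rw [append, ← e]
    rw [List.idxOf_append_of_mem (List.mem_map_of_mem m1), idxOf_map_of_injOn hinj m1]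
  have hi : (append v i).idxOf i = v.length := by
    rw [append, List.idxOf_append_of_notMem hni]; simp
  have l1 := List.idxOf_lt_length_of_mem m1
  have lm := List.idxOf_lt_length_of_mem mm
  rcases eq_or_lt_of_le h1 with h | h
  · subst h
    rw [hm' hm, hi]
    simp [lm]
  · rcases eq_or_lt_of_le h2 with h' | h'
    · have : (append v i).idxOf (m + 1) = v.length := by rw [← h', hi]
      rw [this, h1' h]
      omega
    · rw [hm' (by omega), h1' h]
      omega

/-- Whether an edge lies in `half` depends on its source and label; the labels of the edges in
`half` form an initial segment. -/
theorem mem_half_iff {m : ℕ} (hm : 1 ≤ m) {p : List ℕ} (hp : p ∈ perms (m + 1)) :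
    p ∈ half (m + 1) ↔ lab p = 1 ∨ (lab p ≤ m ∧ (src p).idxOf m < (src p).idxOf 1) := by
  obtain ⟨h0, h1, h2, h3⟩ := exists_eq_append hp
  rw [← append_before_iff hm h0 h1 h2, ← h3, mem_half, ← mem_perms]
  simp [hp]

theorem lab_lt_of_mem_half {m : ℕ} (hm : 1 ≤ m) {p q : List ℕ} (hp : p ∈ perms (m + 1))
    (hp' : p ∉ half (m + 1)) (hq : q ∈ half (m + 1)) (h : src q = src p) : lab q < lab p := by
  have hq' := half_subset _ hq
  rw [mem_half_iff hm hq', h] at hq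
  rw [mem_half_iff hm hp] at hp'
  have := (exists_eq_append hp).2.1
  omega

/-- Moving the first letter to the end turns an edge entering `u` into an edge leaving `u`. -/
theorem perms_balanced (n : ℕ) (u : List ℕ) :
    ((perms n).filter fun p => tgt p = u).card ≤ ((perms n).filter fun p => src p = u).card := by
  refine Finset.card_le_card_of_injOn (fun p => p.rotate 1) ?_ (List.rotate_injective 1).injOn
  intro p hp
  simp only [Finset.coe_filter, Set.mem_ofPred_eq, mem_perms] at hp ⊢
  refine ⟨(List.rotate_perm p 1).trans hp.1, ?_⟩
  rw [← hp.2]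
  cases p <;> simp [src, tgt]

/-- An injection that turns incoming edges of `half n` into outgoing ones. -/
def turn (n : ℕ) (p : List ℕ) : List ℕ :=
  if p.headD 0 = n then append p.tail 1 else p.tail ++ [p.headD 0]

theorem turn_cons (n x : ℕ) (q : List ℕ) :
    turn n (x :: q) = if x = n then append q 1 else q ++ [x] := rfl

/-- Rotation keeps n before 1 unless the first letter is n, since 1 is never first in `half`. If n
is first, the edge of label 1 is taken instead, which always lies in `half`; no rotated edge ends in
1, so injectivity survives. -/
theorem half_balanced {m : ℕ} (hm : 1 ≤ m) (u : List ℕ) :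
    ((half (m + 1)).filter fun p => tgt p = u).card ≤
      ((half (m + 1)).filter fun p => src p = u).card := by
  have hcons : ∀ p ∈ half (m + 1), ∃ x q, p = x :: q ∧ x ≠ 1 := by
    intro p hp
    rw [mem_half] at hp
    rcases p with _ | ⟨x, q⟩
    · simp at hp
    · refine ⟨x, q, rfl, ?_⟩
      rintro rfl
      simp at hp
  refine Finset.card_le_card_of_injOn (turn (m + 1)) ?_ ?_
  · intro p hp
    simp only [Finset.coe_filter, Set.mem_ofPred_eq] at hp ⊢
    obtain ⟨hp, rfl⟩ := hp
    obtain ⟨x, q, rfl, hx⟩ := hcons p hp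
    rw [mem_half] at hp
    have hnd := nodup_of_perm hp.1
    have hlen := length_of_perm hp.1
    rw [List.nodup_cons] at hnd
    by_cases hxm : x = m + 1
    · have hq : q.Perm (List.range' 1 m) := by
        refine perm_range'_of_nodup hnd.2 (by simpa using hlen) fun y hy => ?_
        have h1 := (mem_of_perm hp.1).1 (List.mem_cons_of_mem x hy)
        have h2 : y ≠ x := fun e => hnd.1 (e ▸ hy)
        omega
      simp only [turn_cons, hxm, if_true, List.tail_cons, tgt]
      refine ⟨?_, by rw [src_append hq, red_eq_self hq]⟩
      rw [mem_half, append_before_iff hm hq le_rfl (by omega)]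
      exact ⟨append_perm hq le_rfl (by omega), Or.inl rfl⟩
    · simp only [turn_cons, hxm, if_false, List.tail_cons, tgt]
      refine ⟨?_, by rw [src, List.dropLast_concat]⟩
      rw [mem_half]
      refine ⟨(List.perm_append_singleton x q).trans hp.1, ?_⟩
      have h2 := hp.2
      have mem : ∀ y, y ≠ x → 1 ≤ y → y ≤ m + 1 → y ∈ q := fun y h h' h'' =>
        ((List.mem_cons.1 ((mem_of_perm hp.1).2 ⟨h', h''⟩)).resolve_left h)
      rw [List.idxOf_cons_ne _ hxm, List.idxOf_cons_ne _ hx] at h2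
      rw [List.idxOf_append_of_mem (mem _ (Ne.symm hxm) (by omega) le_rfl),
        List.idxOf_append_of_mem (mem _ (Ne.symm hx) le_rfl (by omega))]
      omega
  · intro p hp p' hp' h
    simp only [Finset.coe_filter, Set.mem_ofPred_eq] at hp hp'
    obtain ⟨x, q, rfl, hx⟩ := hcons p hp.1
    obtain ⟨y, r, rfl, hy⟩ := hcons p' hp'.1
    rw [turn_cons, turn_cons] at h
    simp only [append] at h
    split_ifs at h with h1 h2 h2
    · rw [List.append_left_inj] at h
      rw [h1, h2, (List.map_injective_iff.2 (shift_strictMono 1).injective) h]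
    · have := (List.append_inj' h rfl).2
      simp at this
      exact absurd this.symm hy
    · have := (List.append_inj' h rfl).2
      simp at this
      exact absurd this hx
    · have := List.append_inj' h rfl
      simp at this
      rw [this.1, this.2]

theorem idxOf_reverse {p : List ℕ} (hp : p.Nodup) {x : ℕ} (hx : x ∈ p) :
    p.reverse.idxOf x = p.length - 1 - p.idxOf x := by
  obtain ⟨k, hk, rfl⟩ := List.mem_iff_getElem.1 hx
  rw [hp.idxOf_getElem]
  have h : p[k] = p.reverse[p.length - 1 - k]'(by simp; omega) := by
    rw [List.getElem_reverse]
    congr 1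
    omega
  rw [h, (List.nodup_reverse.2 hp).idxOf_getElem]

theorem reverse_mem_half {n : ℕ} (hn : 2 ≤ n) {p : List ℕ} (hp : p ∈ perms n) :
    p.reverse ∈ half n ↔ p ∉ half n := by
  rw [mem_perms] at hp
  have h1 : 1 ∈ p := (mem_of_perm hp).2 (by omega)
  have hm : n ∈ p := (mem_of_perm hp).2 (by omega)
  have hr : p.reverse.Perm (List.range' 1 n) := (List.reverse_perm p).trans hp
  have l1 := List.idxOf_lt_length_of_mem h1
  have lm := List.idxOf_lt_length_of_mem hm
  have hne : p.idxOf n ≠ p.idxOf 1 := fun e => by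
    have := (List.idxOf_inj hm).1 e
    omega
  simp only [mem_half, hr, hp, true_and, idxOf_reverse (nodup_of_perm hp) h1,
    idxOf_reverse (nodup_of_perm hp) hm]
  omega

/-- Reversal exchanges `half n` with its complement. -/
theorem card_half {n : ℕ} (hn : 2 ≤ n) : (half n).card = n.factorial / 2 := by
  have h : (half n).card = (perms n \ half n).card := by
    refine Finset.card_bij' (fun p _ => p.reverse) (fun p _ => p.reverse) ?_ ?_ (by simp) (by simp)
    · intro p hp
      have hp' := half_subset n hp
      have hr : p.reverse ∈ perms n := mem_perms.2 ((List.reverse_perm p).trans (mem_perms.1 hp'))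
      rw [Finset.mem_sdiff, ← reverse_mem_half hn hr, List.reverse_reverse]
      exact ⟨hr, hp⟩
    · intro p hp
      rw [Finset.mem_sdiff] at hp
      exact (reverse_mem_half hn hp.1).2 hp.2
  have h2 := Finset.card_sdiff_add_card_eq_card (half_subset n)
  rw [card_perms] at h2
  omega

/-! ### Paths of maximal labels to the start -/

/-- Nodes and edges are represented by arbitrary words of distinct letters up to pattern: appending
`y` and dropping `x` is one step, whose label is the rank of `y`. -/
theorem leads_step {P : Finset (List ℕ)} {r u : List ℕ} {x y : ℕ} (hnd : (x :: u ++ [y]).Nodup)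
    (hq : red (x :: u ++ [y]) ∈ P)
    (hmax : ∀ p ∈ P, src p = red (x :: u) → lab p ≤ rank (x :: u ++ [y]) y)
    (h : Leads P src tgt lab r (red (u ++ [y]))) : Leads P src tgt lab r (red (x :: u)) := by
  have e1 : src (red (x :: u ++ [y])) = red (x :: u) := by
    rw [src, red_dropLast_red, List.dropLast_concat]
  have e2 : tgt (red (x :: u ++ [y])) = red (u ++ [y]) := by
    rw [tgt, red_tail_red]; rfl
  have e3 : lab (red (x :: u ++ [y])) = rank (x :: u ++ [y]) y := by
    rw [red_concat hnd, lab_append]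
  rw [← e1]
  refine Leads.step _ hq ?_ (by rwa [e2])
  intro p hp hpq
  rw [e3]
  exact hmax p hp (hpq.trans e1)

theorem rank_eq_length {u : List ℕ} (hu : u.Nodup) {y : ℕ} (h : ∀ x ∈ u, x ≤ y) :
    rank u y = u.length := by
  rw [rank, Finset.filter_true_of_mem (by simpa using h), List.toFinset_card_of_nodup hu]

theorem rank_eq_one {u : List ℕ} {y : ℕ} (hy : y ∈ u) (h : ∀ x ∈ u, y ≤ x) : rank u y = 1 := by
  rw [rank, Finset.card_eq_one]
  refine ⟨y, ?_⟩
  ext x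
  simp only [Finset.mem_filter, List.mem_toFinset, Finset.mem_singleton]
  constructor
  · rintro ⟨hx, hxy⟩
    exact le_antisymm hxy (h x hx)
  · rintro rfl
    exact ⟨hy, le_rfl⟩

theorem rank_second {u : List ℕ} (hu : u.Nodup) {y X : ℕ} (hX : X ∈ u) (hy : y < X)
    (h : ∀ x ∈ u, x ≠ X → x ≤ y) : rank u y = u.length - 1 := by
  have : u.toFinset.filter (· ≤ y) = u.toFinset.erase X := by
    ext x
    simp only [Finset.mem_filter, List.mem_toFinset, Finset.mem_erase]
    constructor
    · rintro ⟨hx, hxy⟩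
      exact ⟨by omega, hx⟩
    · rintro ⟨hx, hxy⟩
      exact ⟨hxy, h x hxy hx⟩
  rw [rank, this, Finset.card_erase_of_mem (by simpa using hX), List.toFinset_card_of_nodup hu]

theorem red_range' {B m : ℕ} : red (List.range' (B + 1) m) = List.range' 1 m := by
  have h : List.range' (B + 1) m = (List.range' 1 m).map (B + ·) := by
    rw [List.map_add_range']
  rw [h, red_map (fun _ _ _ _ h => by simpa using h), red_eq_self (List.Perm.refl _)]

/-- Among all permutations the maximal label is m + 1: each step appends a new largest letter. The
displayed word is the one reached after `j` such steps. -/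
theorem leads_perms_drop {m B : ℕ} {r v : List ℕ} (hv : v.Nodup) (hlen : v.length = m)
    (hB : ∀ x ∈ v, x < B) {j : ℕ} (hj : j ≤ m)
    (h : Leads (perms (m + 1)) src tgt lab r (red (v.drop j ++ List.range' B j))) :
    Leads (perms (m + 1)) src tgt lab r (red v) := by
  induction j with
  | zero => simpa using h
  | succ j ih =>
    refine ih (by omega) ?_
    have hd : v.drop j = v[j] :: v.drop (j + 1) := List.drop_eq_getElem_cons (by omega)
    rw [List.range'_concat, ← List.append_assoc, one_mul] at h
    have hnd : (v.drop j ++ List.range' B j ++ [B + j]).Nodup := by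
      have e : List.range' B j ++ [B + j] = List.range' B (j + 1) := by
        rw [List.range'_concat, one_mul]
      rw [List.append_assoc, e, List.nodup_append]
      refine ⟨hv.sublist (List.drop_sublist _ _), List.nodup_range', ?_⟩
      rintro a ha b hb rfl
      have := hB a (List.mem_of_mem_drop ha)
      rw [List.mem_range'_1] at hb
      omega
    have hl : (v.drop j ++ List.range' B j ++ [B + j]).length = m + 1 := by simp; omega
    have hr := red_perm hnd
    have hk := rank_eq_length hnd (y := B + j) (by
      intro x hx
      simp only [List.mem_append, List.mem_range'_1, List.mem_singleton] at hx
      rcases hx with (hx | hx) | hx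
      · have := hB x (List.mem_of_mem_drop hx)
        omega
      · omega
      · omega)
    rw [hl] at hr hk
    rw [hd] at hr hk hnd ⊢
    refine leads_step hnd (mem_perms.2 hr) (fun p hp _ => ?_) h
    exact (exists_eq_append hp).2.2.1.trans hk.ge

theorem leads_perms {m : ℕ} {v : List ℕ} (hv : v.Nodup) (hlen : v.length = m) :
    Leads (perms (m + 1)) src tgt lab (List.range' 1 m) (red v) := by
  have hB : ∀ x ∈ v, x < v.sum + 1 := fun x hx => Nat.lt_succ_of_le (List.le_sum_of_mem hx)
  refine leads_perms_drop hv hlen hB le_rfl ?_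
  rw [List.drop_eq_nil_of_le hlen.le, List.nil_append, red_range']
  exact Leads.base

/-- Comparison of the positions of the largest and the smallest letter of a word and of its
pattern. -/
theorem red_before_iff {v : List ℕ} (hv : v.Nodup) {X z : ℕ} (hX : X ∈ v) (hz : z ∈ v)
    (hmax : ∀ x ∈ v, x ≤ X) (hmin : ∀ x ∈ v, z ≤ x) :
    (red v).idxOf v.length < (red v).idxOf 1 ↔ v.idxOf X < v.idxOf z := by
  rw [← rank_eq_length hv hmax, ← rank_eq_one hz hmin, red_eq_map,
    idxOf_map_of_injOn (strictMonoOn_rank v).injOn hX,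
    idxOf_map_of_injOn (strictMonoOn_rank v).injOn hz]

/-- If the maximum stands before the minimum, the largest label within `half` is m, so the new
letter goes just below the maximum `X`. -/
theorem leads_half_second {m : ℕ} {r u : List ℕ} {x y X z : ℕ} (hnd : (x :: u ++ [y]).Nodup)
    (hlen : (x :: u).length = m) (hX : X ∈ x :: u) (hz : z ∈ x :: u)
    (hmax : ∀ t ∈ x :: u, t ≠ X → t < y) (hyX : y < X) (hmin : ∀ t ∈ x :: u, z ≤ t)
    (hb : (x :: u).idxOf X < (x :: u).idxOf z)
    (h : Leads (half (m + 1)) src tgt lab r (red (u ++ [y]))) :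
    Leads (half (m + 1)) src tgt lab r (red (x :: u)) := by
  have hm : 1 ≤ m := by simp at hlen; omega
  have hnd' : (x :: u).Nodup := hnd.sublist (List.sublist_append_left _ _)
  have hl : (x :: u ++ [y]).length = m + 1 := by simp at hlen ⊢; omega
  have hr := red_perm hnd
  rw [hl] at hr
  have hk : rank (x :: u ++ [y]) y = m := by
    rw [rank_second hnd (List.mem_append_left _ hX) hyX, hl]
    · rfl
    · intro t ht htX
      rcases List.mem_append.1 ht with ht | ht
      · exact (hmax t ht htX).le
      · simp at ht; omega
  have hb' := (red_before_iff hnd' hX hz (fun t ht => by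
    by_cases e : t = X
    · exact e.le
    · exact ((hmax t ht e).trans hyX).le) hmin).2 hb
  rw [hlen] at hb'
  refine leads_step hnd ?_ (fun p hp _ => ?_) h
  · rw [mem_half_iff hm (mem_perms.2 hr)]
    right
    rw [red_concat hnd, hk, lab_append, src_append (red_perm hnd')]
    exact ⟨le_rfl, hb'⟩
  · rw [hk]
    have := (mem_half_iff hm (half_subset _ hp)).1 hp
    omega

/-- If the maximum does not stand before the minimum, the only outgoing edge of `half` has label 1,
so the new letter is the smallest. -/
theorem leads_half_min {m : ℕ} {r u : List ℕ} {x y X z : ℕ} (hnd : (x :: u ++ [y]).Nodup)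
    (hlen : (x :: u).length = m) (hX : X ∈ x :: u) (hz : z ∈ x :: u)
    (hmax : ∀ t ∈ x :: u, t ≤ X) (hmin : ∀ t ∈ x :: u, z ≤ t) (hy : y < z)
    (hb : ¬ (x :: u).idxOf X < (x :: u).idxOf z)
    (h : Leads (half (m + 1)) src tgt lab r (red (u ++ [y]))) :
    Leads (half (m + 1)) src tgt lab r (red (x :: u)) := by
  have hm : 1 ≤ m := by simp at hlen; omega
  have hnd' : (x :: u).Nodup := hnd.sublist (List.sublist_append_left _ _)
  have hl : (x :: u ++ [y]).length = m + 1 := by simp at hlen ⊢; omega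
  have hr := red_perm hnd
  rw [hl] at hr
  have hk : rank (x :: u ++ [y]) y = 1 := by
    refine rank_eq_one (by simp) fun t ht => ?_
    rcases List.mem_append.1 ht with ht | ht
    · exact hy.le.trans (hmin t ht)
    · simp at ht; omega
  rw [← red_before_iff hnd' hX hz hmax hmin, hlen] at hb
  refine leads_step hnd ?_ (fun p hp hs => ?_) h
  · rw [mem_half_iff hm (mem_perms.2 hr)]
    left
    rw [red_concat hnd, hk, lab_append]
  · rw [hk]
    have := (mem_half_iff hm (half_subset _ hp)).1 hp
    rw [hs] at this
    omega

theorem idxOf_middle {A B : List ℕ} {X : ℕ} (h : (A ++ X :: B).Nodup) :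
    (A ++ X :: B).idxOf X = A.length := by
  have hX : X ∉ A := fun hA => by
    rw [List.nodup_append] at h
    exact h.2.2 X hA X (by simp) rfl
  rw [List.idxOf_append_of_notMem hX]
  simp

theorem idxOf_middle_lt {A B : List ℕ} {X z : ℕ} (h : (A ++ X :: B).Nodup) (hz : z ∈ B) :
    (A ++ X :: B).idxOf X < (A ++ X :: B).idxOf z := by
  rw [idxOf_middle h]
  have h' := List.nodup_append.1 h
  have hzA : z ∉ A := fun hA => h'.2.2 z hA z (by simp [hz]) rfl
  have hzX : X ≠ z := fun e => (List.nodup_cons.1 h'.2.1).1 (e ▸ hz)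
  rw [List.idxOf_append_of_notMem hzA, List.idxOf_cons_ne _ hzX]
  omega

/-- As long as `X` is present the letters N, N + 1, … are appended, each just below `X`; after |A| +
1 steps `A` and `X` have dropped out. The gap between `N` and `X` leaves room for these letters
without renaming. -/
theorem leads_half_gap {m : ℕ} {r A B : List ℕ} {X z N : ℕ} (hnd : (A ++ X :: B).Nodup)
    (hlen : (A ++ X :: B).length = m) (hz : z ∈ B) (hmin : ∀ t ∈ A ++ X :: B, z ≤ t)
    (hN : ∀ t ∈ A ++ B, t < N) (hX : N + A.length < X)
    (h : Leads (half (m + 1)) src tgt lab r (red (B ++ List.range' N (A.length + 1)))) :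
    Leads (half (m + 1)) src tgt lab r (red (A ++ X :: B)) := by
  induction A generalizing B N with
  | nil =>
    refine leads_half_second (X := X) (z := z) (y := N) ?_ hlen (by simp) (by simp [hz]) ?_
      (by simpa using hX) hmin (idxOf_middle_lt (A := []) hnd hz) (by simpa using h)
    · rw [List.nodup_append]
      refine ⟨hnd, by simp, ?_⟩
      rintro a ha b hb rfl
      simp at ha hb hX hN
      rcases ha with ha | ha
      · omega
      · have := hN a ha; omega
    · intro t ht htX
      refine hN t ?_
      simpa [htX] using ht
  | cons a A ih =>
    have hNX : N < X := by omega
    have hnd1 : (a :: A ++ X :: B ++ [N]).Nodup := by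
      rw [List.nodup_append]
      refine ⟨hnd, by simp, ?_⟩
      rintro c hc b hb rfl
      simp at hb
      subst hb
      have h1 := hN c
      simp only [List.mem_append, List.mem_cons] at hc h1
      grind
    have hrest := ih (B := B ++ [N]) (N := N + 1)
      (by simpa using (List.nodup_cons.1 (by simpa using hnd1)).2)
      (by simp at hlen ⊢; omega) (by simp [hz])
      (by
        intro t ht
        have h1 := hmin t
        have h2 := hN z (by simp [hz])
        simp only [List.mem_append, List.mem_cons, List.not_mem_nil] at ht h1
        grind)
      (by
        intro t ht
        have h1 := hN t
        simp only [List.mem_append, List.mem_cons, List.not_mem_nil] at ht h1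
        grind)
      (by simp at hX ⊢; omega)
      (by
        rw [List.append_assoc, List.singleton_append, ← List.range'_succ]
        exact h)
    refine leads_half_second (X := X) (z := z) (y := N) (u := A ++ X :: B) hnd1 hlen (by simp)
      (by simp [hz]) ?_ hNX hmin (idxOf_middle_lt hnd hz) (by simpa using hrest)
    intro t ht htX
    refine hN t ?_
    simpa [htX] using ht

theorem leads_half_of_max_before_min {m : ℕ} {r A B : List ℕ} {X z : ℕ} (hnd : (A ++ X :: B).Nodup)
    (hlen : (A ++ X :: B).length = m) (hz : z ∈ B) (hmin : ∀ t ∈ A ++ X :: B, z ≤ t)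
    (hmax : ∀ t ∈ A ++ B, t < X)
    (h : Leads (half (m + 1)) src tgt lab r (red (B ++ List.range' X (A.length + 1)))) :
    Leads (half (m + 1)) src tgt lab r (red (A ++ X :: B)) := by
  -- Raising only `X` opens the gap needed for |A| + 1 new letters and keeps the pattern.
  let f : ℕ → ℕ := fun t => if t < X then t else t + (A.length + 1)
  have hf : StrictMono f := by
    intro a b hab
    simp only [f]
    split_ifs <;> omega
  have fid : ∀ C : List ℕ, (∀ t ∈ C, t < X) → C.map f = C := fun C hC => by
    conv_rhs => rw [← List.map_id C]
    refine List.map_congr_left fun t ht => ?_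
    simp [f, hC t ht]
  have e : (A ++ X :: B).map f = A ++ (X + (A.length + 1)) :: B := by
    rw [List.map_append, List.map_cons, fid A fun t ht => hmax t (by simp [ht]),
      fid B fun t ht => hmax t (by simp [ht])]
    simp [f]
  rw [← red_map (f := f) (hf.strictMonoOn _), e]
  refine leads_half_gap (N := X) (z := z) ?_ (by simpa using hlen) hz ?_ hmax (by omega) h
  · rw [← e]
    exact hnd.map hf.injective
  · intro t ht
    have h1 := hmin t
    have h2 := hmin X (by simp)
    simp only [List.mem_append, List.mem_cons] at ht h1
    grind

theorem red_zero_cons_range' (X m : ℕ) :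
    red (0 :: List.range' (X + 1) m) = List.range' 1 (m + 1) := by
  let f : ℕ → ℕ := fun i => if i ≤ 1 then i - 1 else X + i - 1
  have e : (List.range' 1 (m + 1)).map f = 0 :: List.range' (X + 1) m := by
    rw [List.range'_succ, List.map_cons]
    congr 1
    rw [← List.map_add_range' (a := 1) 1 m 1, ← List.map_add_range' (a := X) 1 m 1, List.map_map]
    refine List.map_congr_left fun i hi => ?_
    rw [List.mem_range'_1] at hi
    simp only [f, Function.comp]
    split_ifs <;> omega
  rw [← e, red_map, red_eq_self (List.Perm.refl _)]
  intro a ha b hb hab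
  simp only [Set.mem_ofPred_eq, List.mem_range'_1] at ha hb
  simp only [f]
  split_ifs <;> omega

theorem strictMono_succ : StrictMono (· + 1 : ℕ → ℕ) := fun _ _ h => Nat.succ_lt_succ h

/-- Inserting a new smallest letter after raising all letters by one. -/
theorem leads_half_zero {m : ℕ} {r u : List ℕ} {x X z : ℕ} (hnd : (x :: u).Nodup)
    (hlen : (x :: u).length = m) (hX : X ∈ x :: u) (hz : z ∈ x :: u)
    (hmax : ∀ t ∈ x :: u, t ≤ X) (hmin : ∀ t ∈ x :: u, z ≤ t)
    (hb : ¬ (x :: u).idxOf X < (x :: u).idxOf z)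
    (h : Leads (half (m + 1)) src tgt lab r (red (u.map (· + 1) ++ [0]))) :
    Leads (half (m + 1)) src tgt lab r (red (x :: u)) := by
  rw [← red_map (strictMono_succ.strictMonoOn _), List.map_cons]
  have e : (x + 1) :: u.map (· + 1) = (x :: u).map (· + 1) := rfl
  refine leads_half_min (X := X + 1) (z := z + 1) (y := 0) ?_ (by simpa using hlen) ?_ ?_ ?_ ?_
    (by omega) ?_ h
  · rw [e, List.nodup_append]
    refine ⟨hnd.map strictMono_succ.injective, by simp, ?_⟩
    rintro a ha b hb rfl
    obtain ⟨c, -, hc⟩ := List.mem_map.1 ha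
    simp at hb
    omega
  · exact e ▸ List.mem_map_of_mem hX
  · exact e ▸ List.mem_map_of_mem hz
  · intro t ht
    rw [e] at ht
    obtain ⟨c, hc, rfl⟩ := List.mem_map.1 ht
    exact Nat.succ_le_succ (hmax c hc)
  · intro t ht
    rw [e] at ht
    obtain ⟨c, hc, rfl⟩ := List.mem_map.1 ht
    exact Nat.succ_le_succ (hmin c hc)
  · rw [e]
    have hi := strictMono_succ.injective.injOn (s := {t | t ∈ x :: u})
    have h1 := idxOf_map_of_injOn hi hX
    have h2 := idxOf_map_of_injOn hi hz
    omega

theorem exists_max_min {v : List ℕ} (hv : v ≠ []) :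
    (∃ X ∈ v, ∀ t ∈ v, t ≤ X) ∧ ∃ z ∈ v, ∀ t ∈ v, z ≤ t := by
  have hne : v.toFinset.Nonempty := by simpa using hv
  obtain ⟨X, hX, h1⟩ := v.toFinset.exists_max_image id hne
  obtain ⟨z, hz, h2⟩ := v.toFinset.exists_min_image id hne
  simp only [List.mem_toFinset, id] at hX h1 hz h2
  exact ⟨⟨X, hX, h1⟩, ⟨z, hz, h2⟩⟩

/-- With the maximum last, one new minimum 0 is forced. Now the maximum is followed by 0 alone, and
the steps below the maximum flush out everything before 0, leaving 0 followed by an increasing run: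
the pattern 12⋯m. -/
theorem leads_half_max_last {m X c : ℕ} {C : List ℕ} (hnd : (c :: C ++ [X]).Nodup)
    (hlen : (c :: C ++ [X]).length = m) (hmax : ∀ t ∈ c :: C, t < X) :
    Leads (half (m + 1)) src tgt lab (List.range' 1 m) (red (c :: C ++ [X])) := by
  obtain ⟨-, z, hz, hmin⟩ := exists_max_min (v := c :: C ++ [X]) (by simp)
  have hnd' : (C ++ [X]).Nodup := (List.nodup_cons.1 hnd).2
  refine leads_half_zero (X := X) (z := z) hnd hlen (by simp) hz ?_ hmin ?_ ?_
  · intro t ht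
    rcases List.mem_append.1 (show t ∈ c :: C ++ [X] from ht) with ht | ht
    · exact (hmax t ht).le
    · simp at ht; omega
  · have h1 : (c :: C ++ [X]).idxOf X = (c :: C).length := idxOf_middle hnd
    have h2 := List.idxOf_lt_length_of_mem hz
    simp only [List.length_append, List.length_singleton] at h2
    change ¬ (c :: C ++ [X]).idxOf X < (c :: C ++ [X]).idxOf z
    omega
  · have e : (C ++ [X]).map (· + 1) ++ [0] = C.map (· + 1) ++ (X + 1) :: [0] := by simp
    change Leads _ _ _ _ _ (red ((C ++ [X]).map (· + 1) ++ [0]))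
    have hnd2 : ((C ++ [X]).map (· + 1) ++ [0]).Nodup := by
      rw [List.nodup_append]
      refine ⟨hnd'.map strictMono_succ.injective, by simp, ?_⟩
      rintro a ha b hb rfl
      obtain ⟨d, -, hd⟩ := List.mem_map.1 ha
      simp at hb
      omega
    rw [e] at hnd2 ⊢
    refine leads_half_of_max_before_min (z := 0) hnd2 (by simpa using hlen) (by simp) (by simp) ?_ ?_
    · intro t ht
      simp only [List.mem_append, List.mem_map, List.mem_singleton] at ht
      rcases ht with ⟨d, hd, rfl⟩ | rfl
      · exact Nat.succ_lt_succ (hmax d (by simp [hd]))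
      · omega
    · rw [List.singleton_append, red_zero_cons_range']
      have : (C.map (· + 1)).length + 1 + 1 = m := by simpa using hlen
      rw [this]
      exact Leads.base

/-- Steps below the maximum remove everything up to `X` and end with the largest of the new letters.
This is the case of `leads_half_max_last`, since `B` contains `z` and so is nonempty. -/
theorem leads_half_middle {m X z : ℕ} {A B : List ℕ} (hnd : (A ++ X :: B).Nodup)
    (hlen : (A ++ X :: B).length = m) (hz : z ∈ B) (hmin : ∀ t ∈ A ++ X :: B, z ≤ t)
    (hmax : ∀ t ∈ A ++ X :: B, t ≤ X) :
    Leads (half (m + 1)) src tgt lab (List.range' 1 m) (red (A ++ X :: B)) := by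
  have hmax' : ∀ t ∈ A ++ B, t < X := by
    intro t ht
    refine lt_of_le_of_ne (hmax t ?_) ?_
    · simp only [List.mem_append, List.mem_cons] at ht ⊢
      tauto
    · rintro rfl
      exact (List.nodup_middle.1 hnd).notMem ht
  refine leads_half_of_max_before_min hnd hlen hz hmin hmax' ?_
  rcases B with _ | ⟨c, C⟩
  · simp at hz
  have hB : (c :: C).Nodup := hnd.sublist
    ((List.sublist_cons_self _ _).trans (List.sublist_append_right _ _))
  have hnd2 : (c :: C ++ List.range' X (A.length + 1)).Nodup := by
    rw [List.nodup_append]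
    refine ⟨hB, List.nodup_range', ?_⟩
    rintro a ha b hb rfl
    have := hmax' a (List.mem_append_right _ ha)
    rw [List.mem_range'_1] at hb
    omega
  have e : c :: C ++ List.range' X (A.length + 1) =
      c :: (C ++ List.range' X A.length) ++ [X + A.length] := by
    rw [List.range'_concat]; simp
  rw [e] at hnd2 ⊢
  refine leads_half_max_last hnd2 (by simp at hlen ⊢; omega) ?_
  intro t ht
  rw [← List.cons_append, List.mem_append, List.mem_range'_1] at ht
  rcases ht with ht | ht
  · have := hmax' t (List.mem_append_right _ ht)
    omega
  · omega

/-- If the maximum does not yet stand before the minimum, a single forced step appends a new minimum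
and reduces to `leads_half_middle`. -/
theorem leads_half {m : ℕ} (hm : 1 ≤ m) {v : List ℕ} (hv : v.Nodup) (hlen : v.length = m) :
    Leads (half (m + 1)) src tgt lab (List.range' 1 m) (red v) := by
  obtain ⟨⟨X, hX, hmax⟩, z, hz, hmin⟩ := exists_max_min (v := v) (by rintro rfl; simp at hlen; omega)
  by_cases hb : v.idxOf X < v.idxOf z
  · obtain ⟨A, B, rfl⟩ := List.append_of_mem hX
    refine leads_half_middle hv hlen ?_ hmin hmax
    rw [idxOf_middle hv] at hb
    rcases List.mem_append.1 hz with h | h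
    · rw [List.idxOf_append_of_mem h] at hb
      have := List.idxOf_lt_length_of_mem h
      omega
    · rcases List.mem_cons.1 h with rfl | h
      · rw [idxOf_middle hv] at hb
        omega
      · exact h
  · rcases v with _ | ⟨x, u⟩
    · simp at hX
    rcases eq_or_ne u [] with rfl | hu
    · have : m = 1 := by simpa using hlen.symm
      subst this
      have := red_perm hv
      have e : red [x] = List.range' 1 1 := List.perm_singleton.1 this
      rw [e]
      exact Leads.base
    -- The step drops `x`; the maximum has to survive it.
    have hXx : X ≠ x := by
      rintro rfl
      have hzX : z = X := by
        by_contra h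
        rw [List.idxOf_cons_self, List.idxOf_cons_ne _ (Ne.symm h)] at hb
        omega
      obtain ⟨t, ht⟩ := List.exists_mem_of_ne_nil u hu
      have h1 := hmax t (List.mem_cons_of_mem _ ht)
      have h2 := hmin t (List.mem_cons_of_mem _ ht)
      have h3 : t = X := by omega
      exact (List.nodup_cons.1 hv).1 (h3 ▸ ht)
    have hXu : X ∈ u := (List.mem_cons.1 hX).resolve_left hXx
    refine leads_half_zero hv hlen hX hz hmax hmin hb ?_
    obtain ⟨A, B, rfl⟩ := List.append_of_mem hXu
    have e : (A ++ X :: B).map (· + 1) ++ [0] =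
        A.map (· + 1) ++ (X + 1) :: (B.map (· + 1) ++ [0]) := by simp
    have hnd2 : ((A ++ X :: B).map (· + 1) ++ [0]).Nodup := by
      rw [List.nodup_append]
      refine ⟨(List.nodup_cons.1 hv).2.map strictMono_succ.injective, by simp, ?_⟩
      rintro a ha b hb rfl
      obtain ⟨d, -, hd⟩ := List.mem_map.1 ha
      simp at hb
      omega
    have hmax2 : ∀ t ∈ (A ++ X :: B).map (· + 1) ++ [0], t ≤ X + 1 := by
      intro t ht
      rcases List.mem_append.1 ht with ht | ht
      · obtain ⟨d, hd, rfl⟩ := List.mem_map.1 ht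
        exact Nat.succ_le_succ (hmax d (List.mem_cons_of_mem _ hd))
      · simp at ht; omega
    rw [e] at hnd2 hmax2 ⊢
    exact leads_half_middle (z := 0) hnd2 (by simp at hlen ⊢; omega) (by simp) (by simp) hmax2

/-! ### Words as walks: the patterns of their factors -/

/-- The pattern of the factor of length `m` of `w` that starts after `k` letters. -/
def win (m : ℕ) (w : List ℕ) (k : ℕ) : List ℕ := red ((w.drop k).take m)

theorem sigma_succ (n : ℕ) (w : List ℕ) (k : ℕ) : sigma n w (k + 1) = win n w k := rfl

theorem win_perm {n k : ℕ} {w : List ℕ} (hw : w.Nodup) (h : k + n ≤ w.length) :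
    win n w k ∈ perms n := by
  have hnd : ((w.drop k).take n).Nodup :=
    hw.sublist ((List.take_sublist _ _).trans (List.drop_sublist _ _))
  have := red_perm hnd
  rwa [show ((w.drop k).take n).length = n by simp; omega, ← mem_perms] at this

theorem src_win {m k : ℕ} {w : List ℕ} (h : k + m < w.length) :
    src (win (m + 1) w k) = win m w k := by
  rw [src, win, red_dropLast_red, List.dropLast_eq_take, List.take_take, win]
  congr 2
  simp
  omega

theorem tgt_win (m k : ℕ) (w : List ℕ) : tgt (win (m + 1) w k) = win m w (k + 1) := by
  rw [tgt, win, red_tail_red, win, ← List.drop_one, List.drop_take, List.drop_drop]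
  rfl

/-- Appending a letter only shifts the old letters monotonically, so the walk made so far is
unchanged. -/
theorem win_append {n k : ℕ} {w : List ℕ} (b : ℕ) (h : k + n ≤ w.length) :
    win n (append w b) k = win n w k := by
  rw [win, append, List.drop_append_of_le_length (by simp; omega),
    List.take_append_of_le_length (by simp; omega), ← List.map_drop, ← List.map_take, red_map_shift,
    win]

theorem red_rtake_extension {m i : ℕ} {w : List ℕ} (hw : w.Nodup) (hm : m ≤ w.length) (h1 : 1 ≤ i)
    (h2 : i ≤ m + 1) :
    red (extension (w.rtake m) i) = append (win m w (w.length - m)) i := by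
  have hl : (w.rtake m).length = m := by simp [List.rtake]; omega
  have hv : (w.rtake m).Nodup := hw.sublist (List.drop_sublist _ _)
  rw [red_extension hv h1 (by omega), win, List.rtake, List.take_of_length_le (by simp; omega)]

theorem win_append_last {m i : ℕ} {w : List ℕ} (hw : w.Nodup) (hm : m ≤ w.length) (h1 : 1 ≤ i)
    (h2 : i ≤ m + 1) :
    win (m + 1) (append w (extLetter (w.rtake m) i)) (w.length - m) =
      append (win m w (w.length - m)) i := by
  rw [← red_rtake_extension hw hm h1 h2, win, append, List.drop_append_of_le_length (by simp),
    ← List.map_drop, List.take_of_length_le (by simp; omega)]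
  rfl

theorem covers_iff {n : ℕ} {w p : List ℕ} :
    Covers n w p ↔ ∃ k, k + n ≤ w.length ∧ win n w k = red p := by
  constructor
  · rintro ⟨u, ⟨a, c, rfl⟩, hu, hp⟩
    refine ⟨a.length, by simp; omega, ?_⟩
    rw [win, List.append_assoc, List.drop_left, List.take_left' hu, hp]
  · rintro ⟨k, hk, hp⟩
    refine ⟨(w.drop k).take n, ?_, by simp; omega, hp⟩
    exact (List.take_prefix _ _).isInfix.trans (List.drop_suffix _ _).isInfix

theorem extLetter_bounds {v : List ℕ} {L i : ℕ} (hv : ∀ x ∈ v, 1 ≤ x ∧ x ≤ L) (h1 : 1 ≤ i) :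
    1 ≤ extLetter v i ∧ extLetter v i ≤ L + 1 := by
  unfold extLetter
  split_ifs with h
  · have hi : i - 1 < (v.insertionSort (· ≤ ·)).length := by
      rw [List.length_insertionSort]; omega
    rw [List.getD_eq_getElem _ _ hi]
    have := hv _ ((List.mem_insertionSort _).1 (List.getElem_mem hi))
    omega
  · have : ∀ l : List ℕ, (∀ x ∈ l, x ≤ L) → l.foldr max 0 ≤ L := by
      intro l hl
      induction l with
      | nil => simp
      | cons a l ih =>
        have h1 := ih fun x hx => hl x (List.mem_cons_of_mem a hx)
        have h2 := hl a (by simp)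
        simp only [List.foldr_cons]
        omega
    have := this v fun x hx => (hv x hx).2
    omega

/-! ### Words produced by the greedy algorithm -/

/-- The words that the greedy algorithm can produce, described by their patterns. -/
structure IsGreedy (m : ℕ) (w : List ℕ) : Prop where
  perm : w.Perm (List.range' 1 w.length)
  len : m ≤ w.length
  start : win m w 0 = List.range' 1 m
  new : ∀ k, k + m < w.length → ∀ j < k, win (m + 1) w j ≠ win (m + 1) w k
  greedy : ∀ k, k + m < w.length → ∀ q ∈ perms (m + 1), src q = src (win (m + 1) w k) →
    lab q < lab (win (m + 1) w k) → ∃ j < k, win (m + 1) w j = q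

theorem isGreedy_start (m : ℕ) : IsGreedy m (List.range' 1 m) where
  perm := by simp
  len := by simp
  start := by
    rw [win, List.drop_zero, List.take_of_length_le (by simp), red_eq_self (List.Perm.refl _)]
  new := by
    intro k hk
    simp at hk
  greedy := by
    intro k hk
    simp at hk

theorem length_of_step {n : ℕ} {w w' : List ℕ} (h : Step n w w') : w'.length = w.length + 1 := by
  obtain ⟨i, -, rfl⟩ := h
  simp

theorem IsGreedy.nodup {m : ℕ} {w : List ℕ} (h : IsGreedy m w) : w.Nodup := nodup_of_perm h.perm

theorem IsGreedy.step {m : ℕ} {w w' : List ℕ} (h : IsGreedy m w) (hs : Step (m + 1) w w') :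
    IsGreedy m w' := by
  obtain ⟨i, ⟨⟨h1, h2, hc⟩, hmin⟩, rfl⟩ := hs
  rw [Nat.add_sub_cancel] at hc hmin ⊢
  have hlast := win_append_last h.nodup h.len h1 h2
  have hlen := h.len
  have hb := extLetter_bounds (v := w.rtake m) (L := w.length) (i := i)
    (fun x hx => (mem_of_perm h.perm).1 (List.mem_of_mem_drop hx)) h1
  set b := extLetter (w.rtake m) i with hbdef
  have hold : ∀ j, j + m < w.length → win (m + 1) (append w b) j = win (m + 1) w j :=
    fun j hj => win_append b (by omega)
  have hv : (win m w (w.length - m)).Perm (List.range' 1 m) :=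
    mem_perms.1 (win_perm h.nodup (by omega))
  refine ⟨?_, by simp; omega, by rw [win_append b (by omega), h.start], ?_, ?_⟩
  · rw [length_append']
    exact append_perm h.perm hb.1 hb.2
  · intro k hk j hj
    rw [length_append'] at hk
    rw [hold j (by omega)]
    by_cases hkm : k + m < w.length
    · rw [hold k hkm]
      exact h.new k hkm j hj
    -- The only new factor is the last one; it is new because its extension was not covered.
    · obtain rfl : k = w.length - m := by omega
      rw [hlast, ← red_rtake_extension h.nodup h.len h1 h2]
      intro e
      exact hc (covers_iff.2 ⟨j, by omega, e⟩)
  · intro k hk q hq hsrc hlab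
    rw [length_append'] at hk
    by_cases hkm : k + m < w.length
    · rw [hold k hkm] at hsrc hlab
      obtain ⟨j, hj, e⟩ := h.greedy k hkm q hq hsrc hlab
      exact ⟨j, hj, by rw [hold j (by omega), e]⟩
    · obtain rfl : k = w.length - m := by omega
      rw [hlast, src_append hv] at hsrc
      rw [hlast, lab_append] at hlab
      obtain ⟨-, q1, q2, q3⟩ := exists_eq_append hq
      -- By minimality of `i`, an extension of smaller index already occurs.
      have hcov : Covers (m + 1) w (extension (w.rtake m) (lab q)) := by
        by_contra hcon
        have := hmin ⟨q1, q2, hcon⟩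
        omega
      obtain ⟨j, hj, e⟩ := covers_iff.1 hcov
      refine ⟨j, by omega, ?_⟩
      rw [hold j (by omega), e, red_rtake_extension h.nodup h.len q1 q2, ← hsrc, ← q3]

theorem IsGreedy.of_reachable {m : ℕ} {w w' : List ℕ} (h : IsGreedy m w)
    (hs : Relation.ReflTransGen (Step (m + 1)) w w') : IsGreedy m w' := by
  induction hs with
  | refl => exact h
  | tail _ hs ih => exact ih.step hs

/-- If an edge leaving the last node were unused, its label would be an admissible index, and the
least admissible one would give a step. -/
theorem IsGreedy.stuck {m : ℕ} {w : List ℕ} (h : IsGreedy m w) (hs : ¬ ∃ w', Step (m + 1) w w')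
    {p : List ℕ} (hp : p ∈ perms (m + 1)) (hsrc : src p = win m w (w.length - m)) :
    ∃ k < w.length - m, win (m + 1) w k = p := by
  obtain ⟨-, p1, p2, p3⟩ := exists_eq_append hp
  by_contra hcon
  have hne : ∃ i, 1 ≤ i ∧ i ≤ m + 1 ∧ ¬ Covers (m + 1) w (extension (w.rtake m) i) := by
    refine ⟨lab p, p1, p2, fun hc => hcon ?_⟩
    obtain ⟨k, hk, e⟩ := covers_iff.1 hc
    exact ⟨k, by omega, by rw [e, red_rtake_extension h.nodup h.len p1 p2, ← hsrc, ← p3]⟩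
  classical
  exact hs ⟨_, Nat.find hne, ⟨Nat.find_spec hne, fun i hi => Nat.find_min' hne hi⟩, rfl⟩

theorem step_rightUnique (n : ℕ) : Relator.RightUnique (Step n) := by
  rintro w a b ⟨i, hi, rfl⟩ ⟨j, hj, rfl⟩
  rw [hi.unique hj]

theorem IsGreedy.length_le {m : ℕ} {w : List ℕ} (h : IsGreedy m w) :
    w.length - m ≤ (m + 1).factorial := by
  rw [← card_perms, ← Finset.card_range (w.length - m)]
  refine Finset.card_le_card_of_injOn (win (m + 1) w) ?_ ?_
  · intro k hk
    simp only [Finset.coe_range, Set.mem_Iio] at hk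
    exact win_perm h.nodup (by omega)
  · intro a ha b hb hab
    simp only [Finset.coe_range, Set.mem_Iio] at ha hb
    rcases lt_trichotomy a b with hlt | heq | hlt
    · exact absurd hab (h.new b (by omega) a hlt)
    · exact heq
    · exact absurd hab.symm (h.new a (by omega) b hlt)

/-- Distinct factors bound the length, so the algorithm terminates; steps are deterministic, so
reachable words are linearly ordered and the final one is unique. -/
theorem existsUnique_isOutput (m : ℕ) : ∃! w, IsOutput (m + 1) w := by
  have hex : ∃ w, IsOutput (m + 1) w := by
    by_contra hcon
    have grow : ∀ k, ∃ w, Relation.ReflTransGen (Step (m + 1)) (List.range' 1 m) w ∧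
        w.length = m + k := by
      intro k
      induction k with
      | zero => exact ⟨_, .refl, by simp⟩
      | succ k ih =>
        obtain ⟨w, hw, hl⟩ := ih
        obtain ⟨w', hw'⟩ : ∃ w', Step (m + 1) w w' := by
          by_contra hs
          exact hcon ⟨w, hw, hs⟩
        exact ⟨w', hw.tail hw', by rw [length_of_step hw', hl]; omega⟩
    obtain ⟨w, hw, hl⟩ := grow ((m + 1).factorial + 1)
    have := ((isGreedy_start m).of_reachable hw).length_le
    omega
  obtain ⟨w, hw⟩ := hex
  refine ⟨w, hw, fun w' hw' => ?_⟩
  rcases Relation.ReflTransGen.total_of_right_unique (step_rightUnique _) hw.1 hw'.1 with h | h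
  · rcases h.cases_head with h | ⟨c, hc, -⟩
    · exact h.symm
    · exact absurd ⟨c, hc⟩ hw.2
  · rcases h.cases_head with h | ⟨c, hc, -⟩
    · exact h
    · exact absurd ⟨c, hc⟩ hw'.2

/-! ### The two halves of the walk and its midpoint -/

/-- The letters after the first one increase. If the first letter is neither 1 nor n, then 1 comes
second and n later, against membership in `half`. -/
theorem eq_of_mem_half_of_tgt {m : ℕ} (hm : 1 ≤ m) {p : List ℕ} (hp : p ∈ half (m + 1))
    (h : tgt p = List.range' 1 m) : p = (m + 1) :: List.range' 1 m := by
  rw [mem_half] at hp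
  rcases p with _ | ⟨x, q⟩
  · simp at hp
  have e : q = (List.range' 1 m).map (shift x) := by
    rw [← h]
    exact eq_map_shift_red hp.1
  have hx := (mem_of_perm hp.1).1 (show x ∈ x :: q by simp)
  have hb := hp.2
  obtain ⟨m, rfl⟩ : ∃ k, m = k + 1 := ⟨m - 1, by omega⟩
  have hx1 : x ≠ 1 := by
    rintro rfl
    simp at hb
  have hxm : x = m + 1 + 1 := by
    by_contra hne
    rw [e, List.range'_succ, List.map_cons, show shift x 1 = 1 by unfold shift; split_ifs <;> omega,
      List.idxOf_cons_ne _ hne, List.idxOf_cons_ne _ hx1, List.idxOf_cons_self] at hb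
    omega
  rw [hxm]
  congr 1
  rw [e]
  conv_rhs => rw [← List.map_id (List.range' 1 (m + 1))]
  refine List.map_congr_left fun t ht => ?_
  rw [List.mem_range'_1] at ht
  simp only [shift, id]
  split_ifs <;> omega

theorem append_range'_two {m : ℕ} (hm : 1 ≤ m) :
    append (List.range' 1 m) 2 = 1 :: (List.range' 3 (m - 1) ++ [2]) := by
  obtain ⟨m, rfl⟩ : ∃ k, m = k + 1 := ⟨m - 1, by omega⟩
  rw [append, List.range'_succ, List.map_cons, List.cons_append]
  congr 2
  rw [Nat.add_sub_cancel, ← List.map_add_range' (a := 1) (1 + 1) m 1]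
  refine List.map_congr_left fun t ht => ?_
  rw [List.mem_range'_1] at ht
  simp only [shift]
  split_ifs <;> omega

theorem red_range'_two {m : ℕ} :
    red (List.range' 3 m ++ [2]) = List.range' 2 m ++ [1] := by
  have e : List.range' 3 m ++ [2] = (List.range' 2 m ++ [1]).map (1 + ·) := by
    rw [List.map_append, List.map_add_range']; rfl
  have hp : (List.range' 2 m ++ [1]).Perm (List.range' 1 (m + 1)) := by
    rw [List.range'_succ]
    exact List.perm_append_singleton _ _
  rw [e, red_map (fun _ _ _ _ h => by simpa using h), red_eq_self hp]

/-- The first half of a complete greedy word and the whole word as walks. -/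
theorem IsGreedy.halves {m : ℕ} (hm : 1 ≤ m) {w : List ℕ} (h : IsGreedy m w)
    (hs : ¬ ∃ w', Step (m + 1) w w') :
    w.length - m = (m + 1).factorial ∧
    (∀ p ∈ perms (m + 1), ∃ k < (m + 1).factorial, win (m + 1) w k = p) ∧
    win m w ((m + 1).factorial / 2) = List.range' 1 m ∧
    (∀ k < (m + 1).factorial, (win (m + 1) w k ∈ half (m + 1) ↔ k < (m + 1).factorial / 2)) := by
  set K := w.length - m with hK
  have hlen := h.len
  set s := win (m + 1) w
  have hmem : ∀ k < K, s k ∈ perms (m + 1) := fun k hk => win_perm h.nodup (by omega)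
  have hsrc : ∀ k < K, src (s k) = win m w k := fun k hk => src_win (by omega)
  have htgt : ∀ k < K, tgt (s k) = win m w (k + 1) := fun k _ => tgt_win m k w
  have hnew : ∀ k < K, ∀ j < k, s j ≠ s k := fun k hk => h.new k (by omega)
  have hgreedy : ∀ k < K, ∀ q ∈ perms (m + 1), src q = src (s k) → lab q < lab (s k) →
      ∃ j < k, s j = q := fun k hk => h.greedy k (by omega)
  have hinj : ∀ T ≤ K, Set.InjOn s (Finset.range T : Set ℕ) := by
    intro T hT a ha b hb hab
    simp only [Finset.coe_range, Set.mem_Iio] at ha hb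
    rcases lt_trichotomy a b with hlt | heq | hlt
    · exact absurd hab (hnew b (by omega) a hlt)
    · exact heq
    · exact absurd hab.symm (hnew a (by omega) b hlt)
  have hcount : ∀ T ≤ K, ∀ P : Finset (List ℕ), (∀ k < T, s k ∈ P) → (∀ p ∈ P, ∃ k < T, s k = p) →
      T = P.card := by
    intro T hT P h1 h2
    have : P = (Finset.range T).image s := by
      ext p
      simp only [Finset.mem_image, Finset.mem_range]
      exact ⟨h2 p, by rintro ⟨k, hk, rfl⟩; exact h1 k hk⟩
    rw [this, Finset.card_image_of_injOn (hinj T hT), Finset.card_range]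
  have hnode : ∀ p ∈ perms (m + 1), (src p).Nodup ∧ (src p).length = m ∧ red (src p) = src p := by
    intro p hp
    have := (exists_eq_append hp).1
    exact ⟨nodup_of_perm this, length_of_perm this, red_eq_self this⟩
  have hfull := (greedy_walk_covers (perms (m + 1)) src tgt lab (perms_balanced _) K s (win m w) hmem
    hnew hsrc htgt (fun p hp hsp => h.stuck hs hp hsp) hgreedy
    (fun p hp q hq => eq_of_src_lab hp hq) (fun p hp => by
      rw [h.start, ← (hnode p hp).2.2]
      exact leads_perms (hnode p hp).1 (hnode p hp).2.1)).2
  have hKn : K = (m + 1).factorial := by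
    rw [hcount K le_rfl _ hmem hfull, card_perms]
  -- `T` is the first time the walk uses an edge outside `half`, or the total length if there is
  -- none.
  obtain ⟨T, hTK, hThalf, hTleave⟩ : ∃ T ≤ K, (∀ k < T, s k ∈ half (m + 1)) ∧
      (T < K → s T ∉ half (m + 1)) := by
    classical
    have hex : ∃ T, T = K ∨ s T ∉ half (m + 1) := ⟨K, Or.inl rfl⟩
    refine ⟨Nat.find hex, Nat.find_min' hex (Or.inl rfl), fun k hk => ?_, fun hlt => ?_⟩
    · have := Nat.find_min hex hk
      push Not at this
      exact this.2
    · exact (Nat.find_spec hex).resolve_left hlt.ne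
  -- An edge outside `half` has a larger label than every edge of `half` with the same source, so
  -- greediness has already used the latter.
  have hstuck : ∀ p ∈ half (m + 1), src p = win m w T → ∃ k < T, s k = p := by
    intro p hp hsp
    rcases hTK.eq_or_lt with e | hlt
    · rw [e] at hsp ⊢
      exact h.stuck hs (half_subset _ hp) hsp
    · rw [← hsrc T hlt] at hsp
      exact hgreedy T hlt p (half_subset _ hp) hsp
        (lab_lt_of_mem_half hm (hmem T hlt) (hTleave hlt) hp hsp)
  have hhalf := greedy_walk_covers (half (m + 1)) src tgt lab (half_balanced hm) T s (win m w) hThalf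
    (fun k hk => hnew k (by omega)) (fun k hk => hsrc k (by omega)) (fun k hk => htgt k (by omega))
    hstuck (fun k hk q hq => hgreedy k (by omega) q (half_subset _ hq))
    (fun p hp q hq => eq_of_src_lab (half_subset _ hp) (half_subset _ hq)) (fun p hp => by
      have hp := half_subset _ hp
      rw [h.start, ← (hnode p hp).2.2]
      exact leads_half hm (hnode p hp).1 (hnode p hp).2.1)
  have hT : T = (m + 1).factorial / 2 := by
    rw [hcount T hTK _ hThalf hhalf.2, card_half (by omega)]
  rw [← hT, ← hKn]
  refine ⟨rfl, hfull, hhalf.1.trans h.start, fun k hk => ⟨fun hkh => ?_, hThalf k⟩⟩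
  obtain ⟨j, hj, e⟩ := hhalf.2 _ hkh
  have := hinj K le_rfl (by simp; omega) (by simpa using hk) e
  omega

/-- A factor whose smallest letter is the letter `1` of the word. -/
theorem getElem_win_eq_one {n k a : ℕ} {w : List ℕ} (hw : w.Perm (List.range' 1 w.length))
    (hk : k + n ≤ w.length) (ha : a < n) (h1 : w[k + a] = 1) :
    (win n w k)[a]'(by simp [win]; omega) = 1 := by
  have e : ((w.drop k).take n)[a]'(by simp; omega) = 1 := by simpa using h1
  simp only [win, red_eq_map, List.getElem_map, e]
  refine rank_eq_one (e ▸ List.getElem_mem _) fun x hx => ?_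
  exact ((mem_of_perm hw).1 (List.mem_of_mem_drop (List.mem_of_mem_take hx))).1

/-- The position of the letter `1` in a complete greedy word. -/
theorem IsGreedy.letter_one {m T : ℕ} (hm : 1 ≤ m) {w : List ℕ} (h : IsGreedy m w)
    (hT : T + m ≤ w.length) (hroot : win m w T = List.range' 1 m)
    (hhalf : ∀ k, k + m < w.length → (win (m + 1) w k ∈ half (m + 1) ↔ k < T)) :
    w[T]? = some 1 := by
  obtain ⟨d, hd, hd1⟩ := List.mem_iff_getElem.1 ((mem_of_perm h.perm (x := 1)).2 (by omega))
  have hp : ∀ k, k + m < w.length → win (m + 1) w k ∈ perms (m + 1) :=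
    fun k hk => win_perm h.nodup (by omega)
  have hidx : ∀ k a, (hk : k + m < w.length) → (ha : a ≤ m) → k + a = d →
      (win (m + 1) w k).idxOf 1 = a := by
    intro k a hk ha e
    subst e
    have h1 := getElem_win_eq_one h.perm (n := m + 1) (k := k) (a := a) (by omega) (by omega) hd1
    have hlt : a < (win (m + 1) w k).length := by
      rw [length_of_perm (mem_perms.1 (hp k hk))]; omega
    have := (nodup_of_perm (mem_perms.1 (hp k hk))).idxOf_getElem a hlt
    rwa [h1] at this
  -- If 1 came earlier, the factor starting with it would have a pattern in `half` that begins with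
  -- 1.
  have hTd : T ≤ d := by
    by_contra hlt
    have h0 := hidx d 0 (by omega) (by omega) (by omega)
    have h1 := (mem_half.1 ((hhalf d (by omega)).2 (by omega))).2
    omega
  -- If 1 came later, the factor ending with it would have 1 last, hence lie in `half`, although it
  -- starts at or after `T`.
  have hdT : d < T + m := by
    by_contra hlt
    have h0 := hidx (d - m) m (by omega) le_rfl (by omega)
    have hp' := mem_perms.1 (hp (d - m) (by omega))
    have hmem : win (m + 1) w (d - m) ∈ half (m + 1) := by
      rw [mem_half, h0]
      refine ⟨hp', ?_⟩
      have hmm : m + 1 ∈ win (m + 1) w (d - m) := (mem_of_perm hp').2 (by omega)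
      have h1 := List.idxOf_lt_length_of_mem hmm
      rw [length_of_perm hp'] at h1
      have h2 : (win (m + 1) w (d - m)).idxOf (m + 1) ≠ (win (m + 1) w (d - m)).idxOf 1 := fun e => by
        have := (List.idxOf_inj hmm).1 e
        omega
      omega
    have := (hhalf _ (by omega)).1 hmem
    omega
  obtain ⟨a, rfl⟩ : ∃ a, d = T + a := ⟨d - T, by omega⟩
  have h1 := getElem_win_eq_one h.perm (n := m) (k := T) (a := a) (by omega) (by omega) hd1
  simp only [hroot, List.getElem_range'] at h1
  -- The factor at `T` has pattern 12⋯m, in which 1 stands only at the front.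
  obtain rfl : a = 0 := by omega
  rw [List.getElem?_eq_getElem (by omega)]
  simpa using hd1

end GreedyPerm

theorem mainTheorem4 (n : ℕ) (hn : 2 ≤ n) :
    (∃! w, GreedyPerm.IsOutput n w) ∧
    ∀ w, GreedyPerm.IsOutput n w →
      w.length = n.factorial + n - 1 ∧
      GreedyPerm.letter w (n.factorial / 2 + 1) = some 1 ∧
      GreedyPerm.sigma n w (n.factorial / 2) = n :: List.range' 1 (n - 1) ∧
      GreedyPerm.sigma n w (n.factorial / 2 + 1) = 1 :: (List.range' 3 (n - 2) ++ [2]) ∧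
      (3 ≤ n → GreedyPerm.sigma n w (n.factorial / 2 + 2) = List.range' 2 (n - 2) ++ [1, n]) ∧
      {p | ∃ k, 1 ≤ k ∧ k ≤ n.factorial / 2 ∧ GreedyPerm.sigma n w k = p} =
        GreedyPerm.permsBefore n n 1 ∧
      {p | ∃ k, n.factorial / 2 < k ∧ k ≤ n.factorial ∧ GreedyPerm.sigma n w k = p} =
        GreedyPerm.permsBefore n 1 n := by
  open GreedyPerm in
  obtain ⟨m, rfl⟩ : ∃ m, n = m + 1 := ⟨n - 1, by omega⟩
  have hm : 1 ≤ m := by omega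
  refine ⟨existsUnique_isOutput m, fun w hw => ?_⟩
  have h : IsGreedy m w := (isGreedy_start m).of_reachable hw.1
  obtain ⟨hK, hfull, hroot, hhalf⟩ := h.halves hm hw.2
  have hlen := h.len
  have hpos : 2 ≤ (m + 1).factorial := Nat.factorial_le (n := m + 1) (m := 2) (by omega)
  set F := (m + 1).factorial with hF
  set T := F / 2 with hT
  have hmem : ∀ k < F, win (m + 1) w k ∈ perms (m + 1) := fun k hk => win_perm h.nodup (by omega)
  have hrefl : (List.range' 1 m).Perm (List.range' 1 m) := List.Perm.refl _
  have hfresh : ∀ k, T ≤ k → k < F → win (m + 1) w k ∉ half (m + 1) := fun k h1 h2 h3 => by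
    have := (hhalf k h2).1 h3
    omega
  have hσ : win (m + 1) w T = 1 :: (List.range' 3 (m - 1) ++ [2]) := by
    have hTF : T < F := by omega
    obtain ⟨-, i1, i2, i3⟩ := exists_eq_append (hmem T hTF)
    have hs : src (win (m + 1) w T) = List.range' 1 m := by rw [src_win (by omega), hroot]
    have hne1 : lab (win (m + 1) w T) ≠ 1 := fun e =>
      hfresh T le_rfl hTF ((mem_half_iff hm (hmem T hTF)).2 (Or.inl e))
    -- A label above 2 would mean that the edge 134⋯n2 had been used before `T`, but it is not in
    -- `half`.
    have hle : ¬ 2 < lab (win (m + 1) w T) := by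
      intro hlt
      obtain ⟨j, hj, e⟩ := h.greedy T (by omega) (append (List.range' 1 m) 2)
        (mem_perms.2 (append_perm hrefl (by omega) (by omega)))
        (by rw [src_append hrefl, hs]) (by rwa [lab_append])
      have hb := (mem_half.1 ((hhalf j (by omega)).2 hj)).2
      rw [e, append_range'_two hm] at hb
      simp at hb
    rw [i3, hs, show lab (win (m + 1) w T) = 2 by omega, append_range'_two hm]
  refine ⟨by omega, ?_, ?_, ?_, ?_, ?_, ?_⟩
  · exact h.letter_one hm (by omega) hroot fun k hk => hhalf k (by omega)
  · obtain ⟨t, ht⟩ : ∃ t, T = t + 1 := ⟨T - 1, by omega⟩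
    rw [ht, sigma_succ, Nat.add_sub_cancel]
    refine eq_of_mem_half_of_tgt hm ((hhalf t (by omega)).2 (by omega)) ?_
    rw [tgt_win, ← ht, hroot]
  · exact hσ
  · intro h3
    have hF6 : 6 ≤ F := Nat.factorial_le (n := m + 1) (m := 3) (by omega)
    have hTF : T + 1 < F := by omega
    obtain ⟨-, i1, i2, i3⟩ := exists_eq_append (hmem (T + 1) hTF)
    have hs : src (win (m + 1) w (T + 1)) = List.range' 2 (m - 1) ++ [1] := by
      rw [src_win (by omega), ← tgt_win, hσ, tgt, List.tail_cons, red_range'_two]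
    -- In the node 23⋯m1 the maximum stands before the minimum, so all labels up to m belong to
    -- `half` and only m + 1 remains.
    have hl : lab (win (m + 1) w (T + 1)) = m + 1 := by
      by_contra hne
      refine hfresh (T + 1) (by omega) hTF ((mem_half_iff hm (hmem _ hTF)).2 (Or.inr ⟨by omega, ?_⟩))
      rw [hs, List.idxOf_append_of_mem (by rw [List.mem_range'_1]; omega),
        List.idxOf_append_of_notMem (by rw [List.mem_range'_1]; omega)]
      have := List.idxOf_lt_length_of_mem (a := m) (l := List.range' 2 (m - 1))
        (by rw [List.mem_range'_1]; omega)
      omega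
    change win (m + 1) w (T + 1) = _
    rw [i3, hs, hl, append, List.map_append, List.append_assoc]
    congr 1
    · conv_rhs => rw [← List.map_id (List.range' 2 (m + 1 - 2))]
      refine List.map_congr_left fun t ht => ?_
      rw [List.mem_range'_1] at ht
      simp only [shift, id]
      split_ifs <;> omega
    · simp [shift]
      omega
  · ext p
    simp only [Set.mem_ofPred_eq, permsBefore]
    rw [← mem_half]
    constructor
    · rintro ⟨k, h1, h2, rfl⟩
      obtain ⟨k, rfl⟩ : ∃ t, k = t + 1 := ⟨k - 1, by omega⟩
      exact (hhalf k (by omega)).2 (by omega)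
    · intro hp
      obtain ⟨k, hk, rfl⟩ := hfull p (half_subset _ hp)
      have := (hhalf k hk).1 hp
      exact ⟨k + 1, by omega, by omega, rfl⟩
  · ext p
    simp only [Set.mem_ofPred_eq, permsBefore]
    have hcompl : p.Perm (List.range' 1 (m + 1)) →
        (p.idxOf 1 < p.idxOf (m + 1) ↔ p ∉ half (m + 1)) := by
      intro hp
      have hmm : m + 1 ∈ p := (mem_of_perm hp).2 (by omega)
      have hne : p.idxOf (m + 1) ≠ p.idxOf 1 := fun e => by
        have := (List.idxOf_inj hmm).1 e
        omega
      simp only [mem_half, hp, true_and]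
      omega
    constructor
    · rintro ⟨k, h1, h2, rfl⟩
      obtain ⟨k, rfl⟩ : ∃ t, k = t + 1 := ⟨k - 1, by omega⟩
      have hp := mem_perms.1 (hmem k (by omega))
      exact ⟨hp, (hcompl hp).2 (hfresh k (by omega) (by omega))⟩
    · rintro ⟨hp, hb⟩
      obtain ⟨k, hk, rfl⟩ := hfull p (mem_perms.2 hp)
      have h1 := (hcompl hp).1 hb
      rw [hhalf k hk] at h1
      exact ⟨k + 1, by omega, by omega, rfl⟩
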